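/- \textbf{Theorem (AVaR sample complexity).} Consider $K$ arms. For each arm $i$ let $X^i_1,\dots,X^i_N$ be i.i.d. real rewards with distribution function $F_i$, whose law has a continuously differentiable probability density $d_i:\mathbb R\to[0,\infty)$. Suppose that there are constants $M,D,D'$ with $|X^i_t|\le M$ almost surely for all $i,t$, and $d_i(z)\le D$ and $d_i'(z)\le D'$ for all $i$ and all $z\in\mathbb R$. Let $0<\lambda\le 1$, $\varepsilon>0$, $\delta>0$, and let $C_1\ge 0$ be an arbitrary constant. Let $q_i(\varphi)=\inf\{x\in\mathbb R: F_i(x)>\varphi\}$ and $$G_i=\mathrm{AVaR}_\lambda(X^i_1)=\frac1\lambda\int_0^\lambda -q_i(\varphi)\,d\varphi .$$ Let $X^i_{(1)}\le\dots\le X^i_{(N)}$ be the order statistics of $X^i_1,\dots,X^i_N$ and $$\hat G_i(N)=-\frac1\lambda\left(\sum_{j=0}^{\lfloor\lambda N\rfloor-1}\frac1N X^i_{(j+1)}+\Big(\lambda-\frac{\lfloor\lambda N\rfloor}{N}\Big)X^i_{(\lceil\lambda N\rceil)}\right).$$ Let $\lambda'=\lambda'(N)$ be the smallest real number greater than $\lambda$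 such that $N\lambda'$ is an integer. If $$N\ \ge\ \max\left\{\frac{32\,\lambda' M^2}{\varepsilon^2\lambda^2}\log\frac2\delta,\ \frac{\frac16 D'/D^3+2C_1\lambda'}{\varepsilon\lambda},\ 2\right\},$$ then for every arm $i$, $$\mathbb P\left(\big|G_i-\hat G_i(N)\big|>\varepsilon\right)\le\delta .$$ -/

import Mathlib

open MeasureTheory ProbabilityTheory

noncomputable section

/-- Right-continuous quantile function `q(φ) = inf {x | F(x) > φ}` of a distribution `ν` on `ℝ`,
where `F` is the distribution function of `ν`. -/
def quantile (ν : Measure ℝ) (φ : ℝ) : ℝ :=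
  sInf {x : ℝ | φ < cdf ν x}

/-- Value-at-risk at level `φ` of a reward with distribution `ν`. -/
def valueAtRisk (ν : Measure ℝ) (φ : ℝ) : ℝ :=
  -quantile ν φ

/-- Average value-at-risk at level `lam` of a reward with distribution `ν`. -/
def avgValueAtRisk (ν : Measure ℝ) (lam : ℝ) : ℝ :=
  (1 / lam) * ∫ φ in (0 : ℝ)..lam, valueAtRisk ν φ

/-- The `k`-th order statistic `x_(k)` of a finite sample, `1 ≤ k ≤ N` (so `x_(1)` is the least
entry); the value for other `k` is irrelevant and set to `0`. -/
def orderStat {N : ℕ} (x : Fin N → ℝ) (k : ℕ) : ℝ :=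
  if h : 1 ≤ k ∧ k ≤ N then x (Tuple.sort x ⟨k - 1, by omega⟩) else 0

/-- The Riemann-sum estimator of the average value-at-risk from a sample of size `N`. -/
def avgValueAtRiskEstimator {N : ℕ} (lam : ℝ) (x : Fin N → ℝ) : ℝ :=
  -(1 / lam) *
    ((∑ j ∈ Finset.range ⌊lam * N⌋₊, (1 / (N : ℝ)) * orderStat x (j + 1)) +
      (lam - (⌊lam * N⌋₊ : ℝ) / N) * orderStat x ⌈lam * N⌉₊)

end

/-! Choose `q` with `F q = lam`, which exists because the law has no atoms. The quantile transform
gives `lam * AVaR = -(lam * q - e)` with `e = E (q - X)⁺`, and the estimator is `-T / lam`, where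
`T` is the lower tail mean of the sample. Thresholds bound `T` from below and admissible weights
bound it from above (`exists_tailMean`). If `T` is too small, the threshold `q` forces a large sum
of `(q - X)⁺`. If `T` is too large, weights supported on `{x ≤ q}` force a large sum of one of two
shifted versions of `-(q - X)⁺` (`sum_tailShift_ge_of_tailMean_gt`).

All three summands vanish off `{x ≤ q}`, a set of mass `lam`, and are bounded by `2 * M`. Their
second moment is therefore at most `4 * lam * M ^ 2`, and this factor `lam` gives the Bernstein
bound `measureReal_sum_ge_le` the right exponent. Each tail is at most `(δ / 2) ^ 2`, and `3 * (δ /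
2) ^ 2 ≤ δ` when `δ < 1`. -/

/-! ### The lower tail mean of a sample -/

/-- The weights which the lower `lam`-tail mean of a sorted sample of size `N` puts on its entries,
where `m + 1 = ⌈lam * N⌉`. -/
noncomputable def tailWeight (N m : ℕ) (lam : ℝ) (j : ℕ) : ℝ :=
  if j < m then 1 / N else if j = m then lam - m / N else 0

theorem sum_tailWeight_mul {N m : ℕ} (hm : m < N) (lam : ℝ) (g : ℕ → ℝ) :
    ∑ j ∈ Finset.range N, tailWeight N m lam j * g j =
      ∑ j ∈ Finset.range m, (1 / (N : ℝ)) * g j + (lam - m / N) * g m := by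
  have hsub : Finset.range (m + 1) ⊆ Finset.range N := by
    intro j hj
    simp only [Finset.mem_range] at *
    omega
  rw [← Finset.sum_subset hsub, Finset.sum_range_succ]
  · congr 1
    · refine Finset.sum_congr rfl fun j hj => ?_
      rw [tailWeight, if_pos (Finset.mem_range.1 hj)]
    · simp [tailWeight]
  · intro j _ hj
    simp only [Finset.mem_range] at hj
    rw [tailWeight, if_neg (by omega), if_neg (by omega), zero_mul]

theorem exists_ceil_eq_succ {N : ℕ} (hN : 0 < N) {lam : ℝ} (h0 : 0 < lam) (h1 : lam ≤ 1) :
    ∃ m : ℕ, m < N ∧ ⌈lam * N⌉₊ = m + 1 ∧ (m : ℝ) < lam * N ∧ lam * N ≤ m + 1 := by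
  have hN' : (0 : ℝ) < N := by exact_mod_cast hN
  have hpos : 0 < lam * N := by positivity
  have hc : 0 < ⌈lam * N⌉₊ := Nat.ceil_pos.2 hpos
  have hle : ⌈lam * N⌉₊ ≤ N := Nat.ceil_le.2 (by nlinarith)
  obtain ⟨m, hm⟩ : ∃ m, ⌈lam * N⌉₊ = m + 1 := ⟨⌈lam * N⌉₊ - 1, by omega⟩
  refine ⟨m, by omega, hm, Nat.lt_ceil.1 (by omega), ?_⟩
  have := Nat.le_ceil (lam * N)
  rw [hm] at this
  exact_mod_cast this

theorem avgValueAtRiskEstimator_eq_sum_tailWeight {N m : ℕ} (hm : m < N) {lam : ℝ}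
    (hceil : ⌈lam * N⌉₊ = m + 1) (hlt : (m : ℝ) < lam * N) (hle : lam * N ≤ m + 1)
    (x : Fin N → ℝ) :
    avgValueAtRiskEstimator lam x =
      -(1 / lam) * ∑ j ∈ Finset.range N, tailWeight N m lam j * orderStat x (j + 1) := by
  have hN' : (0 : ℝ) < N := by exact_mod_cast (by omega : 0 < N)
  rw [sum_tailWeight_mul hm lam (fun j => orderStat x (j + 1)), avgValueAtRiskEstimator, hceil]
  congr 1
  rcases hle.lt_or_eq with hlt' | heq
  · have hfl : ⌊lam * N⌋₊ = m := (Nat.floor_eq_iff ((Nat.cast_nonneg m).trans hlt.le)).2 ⟨hlt.le, hlt'⟩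
    rw [hfl]
  -- Here `lam * N` is an integer: the fractional term vanishes and the boundary weight `lam - m /
  -- N` is a full `1 / N`.
  · have hfl : ⌊lam * N⌋₊ = m + 1 := by
      rw [heq]
      exact_mod_cast Nat.floor_natCast (R := ℝ) (m + 1)
    have hlam : lam = (m + 1) / N := by field_simp; linarith
    rw [hfl, Finset.sum_range_succ, hlam]
    push_cast
    ring

/-- The estimator is a weighted mean of the sample which puts the largest admissible weight `1 / N`
below some sample point and no weight above it. -/
theorem exists_weights {N : ℕ} (hN : 0 < N) {lam : ℝ} (h0 : 0 < lam) (h1 : lam ≤ 1)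
    (x : Fin N → ℝ) :
    ∃ (v : Fin N → ℝ) (m : Fin N), (∀ i, 0 ≤ v i) ∧ (∀ i, v i ≤ 1 / N) ∧ ∑ i, v i = lam ∧
      (∀ i, x i < x m → v i = 1 / N) ∧ (∀ i, x m < x i → v i = 0) ∧
      avgValueAtRiskEstimator lam x = -(1 / lam) * ∑ i, v i * x i := by
  have hN' : (0 : ℝ) < N := by exact_mod_cast hN
  obtain ⟨m, hm, hceil, hlt, hle⟩ := exists_ceil_eq_succ hN h0 h1
  set σ := Tuple.sort x with hσ
  have hmono : Monotone (x ∘ σ) := Tuple.monotone_sort x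
  have hfrac0 : 0 ≤ lam - m / N := by
    rw [sub_nonneg, div_le_iff₀ hN']
    exact hlt.le
  have hfrac1 : lam - m / N ≤ 1 / N := by
    rw [sub_le_iff_le_add, ← add_div, le_div_iff₀ hN']
    linarith
  have hlow : ∀ i, x i < x (σ ⟨m, hm⟩) → ((σ.symm i : Fin N) : ℕ) < m := by
    intro i hi
    have : (x ∘ σ) (σ.symm i) < (x ∘ σ) ⟨m, hm⟩ := by simpa using hi
    exact hmono.reflect_lt this
  have hhigh : ∀ i, x (σ ⟨m, hm⟩) < x i → m < ((σ.symm i : Fin N) : ℕ) := by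
    intro i hi
    have : (x ∘ σ) ⟨m, hm⟩ < (x ∘ σ) (σ.symm i) := by simpa using hi
    exact hmono.reflect_lt this
  have hsum : ∀ g : Fin N → ℝ, ∑ i, tailWeight N m lam (σ.symm i) * g i =
      ∑ j : Fin N, tailWeight N m lam j * g (σ j) := by
    intro g
    rw [← Equiv.sum_comp σ]
    simp
  refine ⟨fun i => tailWeight N m lam (σ.symm i), σ ⟨m, hm⟩, ?_, ?_, ?_, ?_, ?_, ?_⟩
  · intro i
    dsimp only [tailWeight]
    split_ifs <;> first | assumption | positivity
  · intro i
    dsimp only [tailWeight]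
    split_ifs <;> first | exact le_rfl | assumption | positivity
  · have h := hsum fun _ => 1
    simp only [mul_one] at h
    rw [h, Fin.sum_univ_eq_sum_range (tailWeight N m lam)]
    have := sum_tailWeight_mul hm lam fun _ => 1
    simp only [mul_one, Finset.sum_const, Finset.card_range, nsmul_eq_mul] at this
    rw [this]
    ring
  · intro i hi
    simp [tailWeight, hlow i hi]
  · intro i hi
    have := hhigh i hi
    simp [tailWeight, this.ne', this.le]
  · rw [avgValueAtRiskEstimator_eq_sum_tailWeight hm hceil hlt hle x, hsum x,
      ← Fin.sum_univ_eq_sum_range (fun j => tailWeight N m lam j * orderStat x (j + 1))]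
    congr 1
    refine Finset.sum_congr rfl fun j _ => ?_
    rw [orderStat, dif_pos ⟨by omega, by omega⟩]
    rfl

/-- Each admissible family of weights bounds the lower tail mean from above, and each threshold
bounds it from below. -/
theorem exists_tailMean {N : ℕ} (hN : 0 < N) {lam : ℝ} (h0 : 0 < lam) (h1 : lam ≤ 1)
    (x : Fin N → ℝ) {M : ℝ} (hM : ∀ i, |x i| ≤ M) :
    ∃ T : ℝ, avgValueAtRiskEstimator lam x = -(1 / lam) * T ∧ |T| ≤ lam * M ∧
      (∀ c, lam * c - (1 / N) * ∑ i, max (c - x i) 0 ≤ T) ∧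
      ∀ u : Fin N → ℝ, (∀ i, 0 ≤ u i) → (∀ i, u i ≤ 1 / N) → ∑ i, u i ≤ lam →
        T ≤ ∑ i, u i * x i + M * (lam - ∑ i, u i) := by
  obtain ⟨v, m, hv0, hv1, hv, hlow, hhigh, hest⟩ := exists_weights hN h0 h1 x
  refine ⟨∑ i, v i * x i, hest, ?_, ?_, ?_⟩
  · calc |∑ i, v i * x i| ≤ ∑ i, |v i * x i| := Finset.abs_sum_le_sum_abs _ _
      _ ≤ ∑ i, v i * M := Finset.sum_le_sum fun i _ => by
        rw [abs_mul, abs_of_nonneg (hv0 i)]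
        exact mul_le_mul_of_nonneg_left (hM i) (hv0 i)
      _ = lam * M := by rw [← Finset.sum_mul, hv]
  · intro c
    have : ∑ i, v i * (c - x i) ≤ ∑ i, (1 / (N : ℝ)) * max (c - x i) 0 :=
      Finset.sum_le_sum fun i _ =>
        (mul_le_mul_of_nonneg_left (le_max_left _ 0) (hv0 i)).trans
          (mul_le_mul_of_nonneg_right (hv1 i) (le_max_right _ _))
    simp only [mul_sub, Finset.sum_sub_distrib, ← Finset.sum_mul, ← Finset.mul_sum, hv] at this
    linarith
  · intro u hu0 hu1 hu
    -- Bathtub argument: `v` is maximal below `x m` and zero above it, so every summand is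
    -- nonnegative.
    have : 0 ≤ ∑ i, (u i - v i) * (x i - x m) := Finset.sum_nonneg fun i _ => by
      rcases lt_trichotomy (x i) (x m) with h | h | h
      · rw [hlow i h]
        nlinarith [hu1 i]
      · simp [h]
      · rw [hhigh i h]
        nlinarith [hu0 i]
    simp only [mul_sub, sub_mul, Finset.sum_sub_distrib, ← Finset.sum_mul, hv] at this
    have hxm : x m ≤ M := (le_abs_self _).trans (hM m)
    nlinarith

/-! ### Quantiles and the population tail mean -/

open Set in
theorem continuous_cdf (ν : Measure ℝ) [IsProbabilityMeasure ν] [NullSingletonClass ν] :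
    Continuous (cdf ν) := by
  refine continuous_iff_continuousAt.2 fun x => ?_
  have hleft : Function.leftLim (cdf ν) x = cdf ν x := by
    have h := (cdf ν).measure_singleton x
    rw [measure_cdf, measure_singleton, eq_comm, ENNReal.ofReal_eq_zero] at h
    have := (cdf ν).mono.leftLim_le (le_refl x)
    linarith
  have h1 := ((cdf ν).mono.continuousWithinAt_Iio_iff_leftLim_eq).2 hleft
  have h2 := (cdf ν).right_continuous x
  exact continuousAt_iff_continuous_left'_right'.2 ⟨h1, h2.mono Ioi_subset_Ici_self⟩

open Set in
theorem exists_cdf_eq (ν : Measure ℝ) [IsProbabilityMeasure ν] [NullSingletonClass ν]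
    {M lam : ℝ} (hM : ∀ᵐ x ∂ν, |x| ≤ M) (h0 : 0 ≤ lam) (h1 : lam ≤ 1) :
    ∃ q, |q| ≤ M ∧ cdf ν q = lam := by
  have hM0 : 0 ≤ M := by
    obtain ⟨x, hx⟩ := hM.exists
    exact (abs_nonneg x).trans hx
  have hlo : cdf ν (-M) = 0 := by
    rw [cdf_eq_real, measureReal_def, ENNReal.toReal_eq_zero_iff]
    left
    have hne : ∀ᵐ x ∂ν, x ≠ -M := by
      rw [ae_iff]
      simp
    refine measure_mono_null ?_ (ae_iff.1 (hM.and hne))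
    intro x hx h
    exact h.2 (le_antisymm hx (neg_le_of_abs_le h.1))
  have hhi : cdf ν M = 1 := by
    have : ν (Iic M) = 1 := (prob_compl_eq_zero_iff measurableSet_Iic).1
      (ae_iff.1 (hM.mono fun x hx => show x ∈ Iic M from le_of_abs_le hx))
    rw [cdf_eq_real, measureReal_def, this, ENNReal.toReal_one]
  obtain ⟨q, hq, hq'⟩ := intermediate_value_Icc (by linarith : -M ≤ M)
    (continuous_cdf ν).continuousOn (show lam ∈ Icc (cdf ν (-M)) (cdf ν M) by
      rw [hlo, hhi]; exact ⟨h0, h1⟩)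
  exact ⟨q, abs_le.2 hq, hq'⟩

theorem bddBelow_setOf_lt_cdf (ν : Measure ℝ) {φ : ℝ} (h0 : 0 < φ) :
    BddBelow {x : ℝ | φ < cdf ν x} := by
  obtain ⟨a, ha⟩ := ((tendsto_cdf_atBot ν).eventually (gt_mem_nhds h0)).exists
  refine ⟨a, fun x hx => ?_⟩
  exact ((cdf ν).mono.reflect_lt (ha.trans hx)).le

theorem nonempty_setOf_lt_cdf (ν : Measure ℝ) {φ : ℝ} (h1 : φ < 1) :
    {x : ℝ | φ < cdf ν x}.Nonempty :=
  ((tendsto_cdf_atTop ν).eventually (lt_mem_nhds h1)).exists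

theorem quantile_le_of_lt_cdf (ν : Measure ℝ) {φ x : ℝ} (h0 : 0 < φ) (h : φ < cdf ν x) :
    quantile ν φ ≤ x :=
  csInf_le (bddBelow_setOf_lt_cdf ν h0) h

theorem le_quantile_of_cdf_le (ν : Measure ℝ) {φ x : ℝ} (h1 : φ < 1) (h : cdf ν x ≤ φ) :
    x ≤ quantile ν φ :=
  le_csInf (nonempty_setOf_lt_cdf ν h1) fun _ hy => ((cdf ν).mono.reflect_lt (h.trans_lt hy)).le

theorem le_cdf_of_quantile_le (ν : Measure ℝ) {φ x : ℝ} (h1 : φ < 1) (h : quantile ν φ ≤ x) :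
    φ ≤ cdf ν x := by
  refine ge_of_tendsto (((cdf ν).right_continuous x).mono Set.Ioi_subset_Ici_self) ?_
  filter_upwards [self_mem_nhdsWithin] with y hy
  obtain ⟨z, hz, hzy⟩ := exists_lt_of_csInf_lt (nonempty_setOf_lt_cdf ν h1) (h.trans_lt hy)
  exact hz.le.trans ((cdf ν).mono hzy.le)

open Set in
theorem aemeasurable_quantile (ν : Measure ℝ) :
    AEMeasurable (quantile ν) (volume.restrict (Ioo 0 1)) :=
  aemeasurable_restrict_of_monotoneOn measurableSet_Ioo fun _ ha _ hb hab =>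
    csInf_le_csInf (bddBelow_setOf_lt_cdf ν ha.1) (nonempty_setOf_lt_cdf ν hb.2)
      fun _ hx => hab.trans_lt hx

open Set in
/-- The quantile transform: the quantile function pushes the uniform law on `(0, 1)` to `ν`. -/
theorem map_quantile (ν : Measure ℝ) [IsProbabilityMeasure ν] :
    (volume.restrict (Ioo (0 : ℝ) 1)).map (quantile ν) = ν := by
  have : IsProbabilityMeasure (volume.restrict (Ioo (0 : ℝ) 1)) := ⟨by simp⟩
  have := Measure.isProbabilityMeasure_map (aemeasurable_quantile ν)
  refine Measure.ext_of_Iic _ _ fun x => ?_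
  rw [Measure.map_apply_of_aemeasurable (aemeasurable_quantile ν) measurableSet_Iic, ← ofReal_cdf,
    Measure.restrict_apply' measurableSet_Ioo]
  -- The two inclusions differ at most in the endpoints `0` and `F x`, which are Lebesgue-null.
  refine le_antisymm ?_ ?_
  · calc volume (quantile ν ⁻¹' Iic x ∩ Ioo 0 1) ≤ volume (Icc 0 (cdf ν x)) :=
          measure_mono fun φ ⟨hq, h0, h1⟩ => ⟨h0.le, le_cdf_of_quantile_le ν h1 hq⟩
      _ = ENNReal.ofReal (cdf ν x) := by simp
  · calc ENNReal.ofReal (cdf ν x) = volume (Ioo 0 (cdf ν x)) := by simp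
      _ ≤ volume (quantile ν ⁻¹' Iic x ∩ Ioo 0 1) := measure_mono fun φ ⟨h0, hx⟩ => ⟨quantile_le_of_lt_cdf ν h0 hx, h0,
          hx.trans_le (cdf_le_one ν x)⟩

-- The quantile function is at most `q` on `(0, lam)` and at least `q` on `[lam, 1)`. Transporting
-- `(q - x)⁺` to `(0, 1)` thus leaves exactly the integral of `q - quantile` over `(0, lam)`.
open Set in
theorem avgValueAtRisk_eq (ν : Measure ℝ) [IsProbabilityMeasure ν] {q lam : ℝ}
    (h0 : 0 < lam) (h1 : lam ≤ 1) (hq : cdf ν q = lam)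
    (hint : Integrable (fun x => max (q - x) 0) ν) :
    avgValueAtRisk ν lam = -(1 / lam) * (lam * q - ∫ x, max (q - x) 0 ∂ν) := by
  have hpush : ∫ x, max (q - x) 0 ∂ν = ∫ φ in Ioo (0 : ℝ) 1, max (q - quantile ν φ) 0 := by
    conv_lhs => rw [← map_quantile ν]
    exact integral_map (aemeasurable_quantile ν) (by fun_prop)
  have hint' : IntegrableOn (fun φ => max (q - quantile ν φ) 0) (Ioo 0 1) := by
    rw [← map_quantile ν] at hint
    exact hint.comp_aemeasurable (aemeasurable_quantile ν)
  have hsub : Ioo (0 : ℝ) lam ⊆ Ioo 0 1 := Ioo_subset_Ioo_right h1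
  have heq : EqOn (fun φ => max (q - quantile ν φ) 0) (fun φ => q - quantile ν φ) (Ioo 0 lam) :=
    fun φ hφ => max_eq_left (sub_nonneg.2 (quantile_le_of_lt_cdf ν hφ.1 (hq ▸ hφ.2)))
  have hcut : ∫ x, max (q - x) 0 ∂ν = ∫ φ in Ioo (0 : ℝ) lam, (q - quantile ν φ) := by
    rw [hpush, ← setIntegral_congr_fun measurableSet_Ioo heq]
    refine setIntegral_eq_of_subset_of_forall_sdiff_eq_zero measurableSet_Ioo hsub ?_
    intro φ hφ
    have : lam ≤ φ := not_lt.1 fun h => hφ.2 ⟨hφ.1.1, h⟩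
    exact max_eq_right (sub_nonpos.2 (le_quantile_of_cdf_le ν hφ.1.2 (hq.trans_le this)))
  have hint'' : IntegrableOn (fun φ => q - quantile ν φ) (Ioo 0 lam) :=
    (hint'.mono_set hsub).congr_fun heq measurableSet_Ioo
  have hvar : ∫ φ in Ioo (0 : ℝ) lam, valueAtRisk ν φ =
      (∫ φ in Ioo (0 : ℝ) lam, (q - quantile ν φ)) - lam * q := by
    have hc : ∫ _ in Ioo (0 : ℝ) lam, q = lam * q := by simp [h0.le]
    rw [← hc, ← integral_sub hint'' (integrable_const q)]
    refine integral_congr_ae (Filter.Eventually.of_forall fun φ => ?_)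
    simp [valueAtRisk]
  rw [avgValueAtRisk, intervalIntegral.integral_of_le h0.le, integral_Ioc_eq_integral_Ioo, hvar,
    hcut]
  ring

/-! ### A Bernstein bound for functions of small support -/

theorem exp_le_one_add_add_sq {t : ℝ} (ht : |t| ≤ 1) : Real.exp t ≤ 1 + t + t ^ 2 := by
  have := (abs_le.1 (Real.abs_exp_sub_one_sub_id_le ht)).2
  linarith

/-- An exponential moment bound for a bounded function in terms of the measure of its support. -/
theorem integral_exp_mul_le {ν : Measure ℝ} [IsProbabilityMeasure ν] {f : ℝ → ℝ} {s : Set ℝ}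
    {U t : ℝ} (hf : Measurable f) (hs : MeasurableSet s) (hfs : ∀ x ∉ s, f x = 0)
    (hU : ∀ᵐ x ∂ν, |f x| ≤ U) (ht : |t| * U ≤ 1) :
    ∫ x, Real.exp (t * f x) ∂ν ≤ Real.exp (t * ∫ x, f x ∂ν + t ^ 2 * (ν.real s * U ^ 2)) := by
  have hfint : Integrable f ν :=
    Integrable.of_bound hf.aestronglyMeasurable U (by simpa [Real.norm_eq_abs] using hU)
  have hind : Integrable (s.indicator fun _ => U ^ 2) ν := (integrable_const _).indicator hs
  have hle : ∀ᵐ x ∂ν, Real.exp (t * f x) ≤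
      1 + t * f x + t ^ 2 * s.indicator (fun _ => U ^ 2) x := by
    filter_upwards [hU] with x hx
    have habs : |t * f x| ≤ 1 := by
      rw [abs_mul]
      exact (mul_le_mul_of_nonneg_left hx (abs_nonneg t)).trans ht
    refine (exp_le_one_add_add_sq habs).trans ?_
    rw [mul_pow]
    have : f x ^ 2 ≤ s.indicator (fun _ => U ^ 2) x := by
      by_cases h : x ∈ s
      · rw [Set.indicator_of_mem h]
        exact sq_le_sq' (neg_le_of_abs_le hx) (le_of_abs_le hx)
      · simp [h, hfs x h]
    nlinarith [sq_nonneg t]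
  have hlin : Integrable (fun x => 1 + t * f x) ν := (integrable_const _).add (hfint.const_mul t)
  have hint : Integrable (fun x => 1 + t * f x + t ^ 2 * s.indicator (fun _ => U ^ 2) x) ν :=
    hlin.add (hind.const_mul _)
  have hexp : Integrable (fun x => Real.exp (t * f x)) ν := by
    refine Integrable.mono' hint (by fun_prop) ?_
    filter_upwards [hle] with x hx
    rwa [Real.norm_eq_abs, Real.abs_exp]
  calc ∫ x, Real.exp (t * f x) ∂ν
      ≤ ∫ x, (1 + t * f x + t ^ 2 * s.indicator (fun _ => U ^ 2) x) ∂ν :=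
        integral_mono_ae hexp hint hle
    _ = t * ∫ x, f x ∂ν + t ^ 2 * (ν.real s * U ^ 2) + 1 := by
        rw [integral_add hlin (hind.const_mul _),
          integral_add (integrable_const _) (hfint.const_mul t), integral_const_mul,
          integral_const_mul, integral_indicator_const _ hs]
        simp
        ring
    _ ≤ _ := Real.add_one_le_exp _

/-- A Bernstein-type upper tail bound for the sum of a bounded function over an i.i.d. sample. -/
theorem measureReal_sum_ge_le {Ω : Type*} [MeasurableSpace Ω] {μ : Measure Ω}
    [IsProbabilityMeasure μ] {N : ℕ} {ν : Measure ℝ} [IsProbabilityMeasure ν]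
    {X : Fin N → Ω → ℝ} (hlaw : ∀ t, HasLaw (X t) ν μ) (hindep : iIndepFun X μ)
    {f : ℝ → ℝ} {s : Set ℝ} (hf : Measurable f) (hs : MeasurableSet s)
    (hfs : ∀ x ∉ s, f x = 0) {U lam η : ℝ} (hU : ∀ᵐ x ∂ν, |f x| ≤ U) (hU0 : 0 < U)
    (hlam : 0 < lam) (hslam : ν.real s ≤ lam) (hη0 : 0 ≤ η) (hη : η ≤ lam * U) :
    μ.real {ω | N * (∫ x, f x ∂ν + η) ≤ ∑ t, f (X t ω)} ≤
      Real.exp (-(N * η ^ 2 / (4 * lam * U ^ 2))) := by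
  set m := ∫ x, f x ∂ν
  -- Minimizer of `-r * η + r ^ 2 * lam * U ^ 2`; `η ≤ lam * U` keeps `r * U` in the range of the
  -- quadratic bound for `exp`.
  set r := η / (2 * lam * U ^ 2) with hr
  have hr0 : 0 ≤ r := by positivity
  have hrU : |r| * U ≤ 1 := by
    rw [abs_of_nonneg hr0, hr, div_mul_eq_mul_div, div_le_one (by positivity)]
    nlinarith [mul_le_mul_of_nonneg_right hη hU0.le, mul_pos hlam (pow_pos hU0 2)]
  set Y : Fin N → Ω → ℝ := fun t ω => f (X t ω)
  have hYm : ∀ t, AEMeasurable (Y t) μ := fun t => hf.comp_aemeasurable (hlaw t).aemeasurable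
  have hYi : iIndepFun Y μ := hindep.comp (fun _ => f) fun _ => hf
  have hYU : ∀ᵐ ω ∂μ, ∀ t, |Y t ω| ≤ U := by
    refine ae_all_iff.2 fun t => ?_
    have := hU
    rw [← (hlaw t).map_eq] at this
    exact ae_of_ae_map (hlaw t).aemeasurable this
  have hmgf : ∀ t, mgf (Y t) μ r ≤ Real.exp (r * m + r ^ 2 * (lam * U ^ 2)) := fun t => by
    have h := (hlaw t).integral_comp (f := fun x => Real.exp (r * f x)) (by fun_prop)
    rw [mgf]
    refine (h.trans_le (integral_exp_mul_le hf hs hfs hU hrU)).trans ?_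
    gcongr
  have hint : Integrable (fun ω => Real.exp (r * ∑ t, Y t ω)) μ := by
    refine Integrable.of_bound (C := Real.exp (r * (N * U))) ?_ ?_
    · exact (Real.measurable_exp.comp_aemeasurable
        ((Finset.aemeasurable_fun_sum _ fun t _ => hYm t).const_mul r)).aestronglyMeasurable
    · filter_upwards [hYU] with ω hω
      rw [Real.norm_eq_abs, Real.abs_exp]
      have : ∑ t, Y t ω ≤ N * U := by
        simpa using Finset.sum_le_card_nsmul Finset.univ (fun t => Y t ω) U
          fun t _ => le_of_abs_le (hω t)
      gcongr
  have hsum : mgf (fun ω => ∑ t, Y t ω) μ r ≤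
      Real.exp (r * m + r ^ 2 * (lam * U ^ 2)) ^ N := by
    have h := hYi.mgf_sum₀ (t := r) hYm Finset.univ
    have heq : (∑ t, Y t) = fun ω => ∑ t, Y t ω := by
      ext ω
      simp
    rw [heq] at h
    rw [h]
    simpa using Finset.prod_le_prod (s := Finset.univ) (fun t _ => mgf_nonneg) fun t _ => hmgf t
  refine (measure_ge_le_exp_mul_mgf _ hr0 hint).trans ?_
  refine (mul_le_mul_of_nonneg_left hsum (Real.exp_pos _).le).trans_eq ?_
  rw [← Real.exp_nat_mul, ← Real.exp_add, hr]
  congr 1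
  field_simp
  ring

/-! ### Reduction of an excessive tail mean to sums over the sample -/

/-- The truncated function `x ↦ c - (q - x)` on `(-∞, q]`, extended by `0`. -/
noncomputable def tailShift (q c x : ℝ) : ℝ :=
  (Set.Iic q).indicator (fun _ => c) x - max (q - x) 0

theorem tailShift_of_le {q c x : ℝ} (h : x ≤ q) : tailShift q c x = c - (q - x) := by
  rw [tailShift, Set.indicator_of_mem (Set.mem_Iic.2 h), max_eq_left (sub_nonneg.2 h)]

theorem tailShift_of_lt {q c x : ℝ} (h : q < x) : tailShift q c x = 0 := by
  rw [tailShift, Set.indicator_of_notMem (by simpa using h), max_eq_right (sub_nonpos.2 h.le),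
    sub_zero]

theorem measurable_tailShift (q c : ℝ) : Measurable (tailShift q c) :=
  (measurable_const.indicator measurableSet_Iic).sub (by fun_prop)

theorem integrable_max_sub {ν : Measure ℝ} [IsProbabilityMeasure ν] {M : ℝ}
    (hM : ∀ᵐ x ∂ν, |x| ≤ M) (q : ℝ) : Integrable (fun x => max (q - x) 0) ν := by
  have hid : Integrable (fun x : ℝ => x) ν :=
    Integrable.of_bound (by fun_prop) M (by simpa [Real.norm_eq_abs] using hM)
  exact ((integrable_const q).sub hid).pos_part

theorem integral_tailShift {ν : Measure ℝ} [IsProbabilityMeasure ν] {q : ℝ} (c : ℝ)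
    (hint : Integrable (fun x => max (q - x) 0) ν) :
    ∫ x, tailShift q c x ∂ν = cdf ν q * c - ∫ x, max (q - x) 0 ∂ν := by
  unfold tailShift
  rw [integral_sub ((integrable_const c).indicator measurableSet_Iic) hint,
    integral_indicator_const _ measurableSet_Iic, cdf_eq_real, smul_eq_mul]

theorem integral_max_sub_le {ν : Measure ℝ} [IsProbabilityMeasure ν] {M q : ℝ}
    (hM : ∀ᵐ x ∂ν, |x| ≤ M) :
    ∫ x, max (q - x) 0 ∂ν ≤ cdf ν q * (q + M) := by
  have hnn : 0 ≤ ∫ x, tailShift q (q + M) x ∂ν := by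
    refine integral_nonneg_of_ae ?_
    filter_upwards [hM] with x hx
    rcases le_or_gt x q with h | h
    · rw [tailShift_of_le h, Pi.zero_apply]
      linarith [neg_le_of_abs_le hx]
    · rw [tailShift_of_lt h, Pi.zero_apply]
  rw [integral_tailShift _ (integrable_max_sub hM q)] at hnn
  linarith

open Finset in
/-- If the lower tail mean `T` of a sample exceeds `lam * q - e + η`, then one of two sums of
`tailShift` over the sample is large. -/
theorem sum_tailShift_ge_of_tailMean_gt {N : ℕ} (hN : 0 < N) {lam M q e η T : ℝ} (h0 : 0 < lam)
    (x : Fin N → ℝ)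
    (hT : ∀ u : Fin N → ℝ, (∀ i, 0 ≤ u i) → (∀ i, u i ≤ 1 / N) → ∑ i, u i ≤ lam →
        T ≤ ∑ i, u i * x i + M * (lam - ∑ i, u i)) (hlt : lam * q - e + η < T) :
    N * (lam * (q - M) - e + η) ≤ ∑ i, tailShift q (q - M) (x i) ∨
      N * (lam * max ((e - η) / lam) 0 - e + η) ≤
        ∑ i, tailShift q (max ((e - η) / lam) 0) (x i) := by
  have hN' : (0 : ℝ) < N := by exact_mod_cast hN
  set k : ℕ := #{i | x i ≤ q} with hk
  have hshift : ∀ c, ∑ i, tailShift q c (x i) =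
      ∑ i, (if x i ≤ q then x i else 0) - k * (q - c) := by
    intro c
    have : ∀ i, tailShift q c (x i) =
        (if x i ≤ q then x i else 0) - (if x i ≤ q then (q - c) else 0) := by
      intro i
      split_ifs with h
      · rw [tailShift_of_le h]
        ring
      · rw [tailShift_of_lt (not_le.1 h), sub_zero]
    simp only [this, sum_sub_distrib]
    simp only [sum_ite, sum_const, nsmul_eq_mul, hk, mul_zero, add_zero]
  have hw : ∀ a : ℝ, ∑ i, (if x i ≤ q then a else 0) = a * k := fun a => by
    simp [sum_ite, hk, mul_comm]
  have hwx : ∀ a : ℝ, ∑ i, (if x i ≤ q then a else 0) * x i =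
      a * ∑ i, (if x i ≤ q then x i else 0) := fun a => by
    rw [mul_sum]
    exact sum_congr rfl fun i _ => by split_ifs <;> simp
  rcases le_or_gt (k : ℝ) (lam * N) with hkN | hkN
  -- At most `lam * N` points lie below `q`: each gets weight `1 / N`, and the missing mass is
  -- priced at `M`, whence the shift `q - M`.
  · left
    have h := hT (fun i => if x i ≤ q then 1 / (N : ℝ) else 0)
      (fun i => by split_ifs <;> positivity)
      (fun i => by split_ifs <;> first | exact le_rfl | positivity)
      (by rw [hw, one_div_mul_eq_div, div_le_iff₀ hN']; exact hkN)
    rw [hw, hwx] at h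
    have h' := mul_le_mul_of_nonneg_left (hlt.le.trans h) hN'.le
    rw [hshift]
    have e1 : (N : ℝ) * (1 / N * ∑ i, (if x i ≤ q then x i else 0) + M * (lam - 1 / N * k)) =
        ∑ i, (if x i ≤ q then x i else 0) + M * (lam * N - k) := by
      field_simp
    rw [e1] at h'
    linarith
  -- Too many points lie below `q`: the mass `lam` is spread evenly over them.
  · right
    have hk0 : (0 : ℝ) < k := lt_of_le_of_lt (by positivity) hkN
    have hka : lam / k * k = lam := div_mul_cancel₀ _ hk0.ne'
    have h := hT (fun i => if x i ≤ q then lam / k else 0)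
      (fun i => by split_ifs <;> positivity)
      (fun i => by
        split_ifs
        · rw [div_le_div_iff₀ hk0 hN']
          linarith
        · positivity)
      (by rw [hw, hka])
    rw [hw, hwx, hka, sub_self, mul_zero, add_zero] at h
    -- For `η ≤ e` this makes `lam * c - e + η` zero, so only the sign of the sum matters and the
    -- random factor `lam / k` is harmless. For `e < η` the clamp at `0` makes the sum nonpositive,
    -- a contradiction.
    set c := max ((e - η) / lam) 0 with hc
    have hS : ∑ i, (if x i ≤ q then x i else 0) = ∑ i, tailShift q c (x i) + k * (q - c) := by
      rw [hshift]
      ring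
    have hlt' : lam * c - e + η < lam / k * ∑ i, tailShift q c (x i) := by
      rw [hS, mul_add, ← mul_assoc, hka] at h
      linarith
    rcases le_or_gt η e with he | he
    · have hce : lam * c = e - η := by
        rw [hc, max_eq_left (div_nonneg (sub_nonneg.2 he) h0.le)]
        field_simp
      rw [hce] at hlt' ⊢
      have := (mul_pos_iff_of_pos_left (div_pos h0 hk0)).1 (by linarith : 0 < lam / k * _)
      linarith
    · have hc0 : c = 0 := max_eq_right (div_nonpos_of_nonpos_of_nonneg (by linarith) h0.le)
      have : ∑ i, tailShift q c (x i) ≤ 0 := sum_nonpos fun i _ => by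
        rw [hc0]
        rcases le_or_gt (x i) q with h | h
        · rw [tailShift_of_le h]
          linarith
        · rw [tailShift_of_lt h]
      have := mul_nonpos_of_nonneg_of_nonpos (div_pos h0 hk0).le this
      rw [hc0] at hlt'
      rw [hc0] at this
      linarith

/-! ### Deviation probabilities and the sample size -/

/-- Both quantities lie in `[-M, M]`. This settles `ε > 2 * M`, which the Bernstein bound does not
cover. -/
theorem abs_avgValueAtRisk_sub_estimator_le {ν : Measure ℝ} [IsProbabilityMeasure ν]
    [NullSingletonClass ν] {M : ℝ} (hM : ∀ᵐ x ∂ν, |x| ≤ M) {N : ℕ} (hN : 0 < N) {lam : ℝ}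
    (h0 : 0 < lam) (h1 : lam ≤ 1) {x : Fin N → ℝ} (hx : ∀ i, |x i| ≤ M) :
    |avgValueAtRisk ν lam - avgValueAtRiskEstimator lam x| ≤ 2 * M := by
  obtain ⟨q, hqM, hq⟩ := exists_cdf_eq ν hM h0.le h1
  obtain ⟨T, hest, hTM, -, -⟩ := exists_tailMean hN h0 h1 x hx
  have he := integral_max_sub_le (q := q) hM
  have he0 : 0 ≤ ∫ x, max (q - x) 0 ∂ν := integral_nonneg fun x => le_max_right _ _
  rw [avgValueAtRisk_eq ν h0 h1 hq (integrable_max_sub hM q), hest, ← mul_sub, abs_mul, abs_neg,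
    abs_of_pos (by positivity : 0 < 1 / lam), one_div_mul_eq_div, div_le_iff₀ h0]
  rw [hq] at he
  have := abs_le.1 hTM
  have := mul_le_mul_of_nonneg_left (abs_le.1 hqM).2 h0.le
  rw [abs_le]
  constructor <;> nlinarith

/-- Concentration of the estimator of the average value-at-risk around its target. -/
theorem measureReal_lt_abs_avgValueAtRisk_sub_estimator_le {Ω : Type*} [MeasurableSpace Ω]
    {μ : Measure Ω} [IsProbabilityMeasure μ] {N : ℕ} (hN : 0 < N) {ν : Measure ℝ}
    [IsProbabilityMeasure ν] [NullSingletonClass ν] {X : Fin N → Ω → ℝ}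
    (hlaw : ∀ t, HasLaw (X t) ν μ) (hindep : iIndepFun X μ) {M : ℝ}
    (hM : ∀ᵐ x ∂ν, |x| ≤ M) (hM0 : 0 < M) {lam ε : ℝ} (h0 : 0 < lam) (h1 : lam ≤ 1)
    (hε : 0 ≤ ε) (hεM : ε ≤ 2 * M) :
    μ.real {ω | ε < |avgValueAtRisk ν lam - avgValueAtRiskEstimator lam (fun t => X t ω)|} ≤
      3 * Real.exp (-(N * ε ^ 2 * lam / (16 * M ^ 2))) := by
  have hN' : (0 : ℝ) < N := by exact_mod_cast hN
  obtain ⟨q, hqM, hq⟩ := exists_cdf_eq ν hM h0.le h1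
  obtain ⟨hq1, hq2⟩ := abs_le.1 hqM
  have hint := integrable_max_sub hM q
  have hele := integral_max_sub_le (q := q) hM
  set e := ∫ x, max (q - x) 0 ∂ν with he
  set η := lam * ε with hη
  have hη0 : 0 ≤ η := by positivity
  have hηM : η ≤ lam * (2 * M) := mul_le_mul_of_nonneg_left hεM h0.le
  have hslam : ν.real (Set.Iic q) ≤ lam := by rw [← cdf_eq_real, hq]
  have hexp : N * η ^ 2 / (4 * lam * (2 * M) ^ 2) = N * ε ^ 2 * lam / (16 * M ^ 2) := by
    rw [hη]
    field_simp
    ring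
  set c := max ((e - η) / lam) 0 with hc
  have hc0 : 0 ≤ c := le_max_right _ _
  -- With `0 ≤ c ≤ 2 * M` and `0 ≤ q - x ≤ 2 * M`, the clamped shift obeys the same bound `2 * M` as
  -- the other two summands.
  have hcM : c ≤ 2 * M := by
    refine max_le ?_ (by positivity)
    rw [div_le_iff₀ h0]
    rw [hq] at hele
    nlinarith
  have hshift : ∀ b, (∀ x, |x| ≤ M → x ≤ q → |b - (q - x)| ≤ 2 * M) →
      μ.real {ω | N * (lam * b - e + η) ≤ ∑ t, tailShift q b (X t ω)} ≤
        Real.exp (-(N * ε ^ 2 * lam / (16 * M ^ 2))) := by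
    intro b hb
    rw [← hexp, ← hq, he, ← integral_tailShift b hint, hq]
    refine measureReal_sum_ge_le hlaw hindep (measurable_tailShift q b) measurableSet_Iic
      (fun x hx => tailShift_of_lt (not_le.1 hx)) ?_ (by positivity) h0 hslam hη0 hηM
    filter_upwards [hM] with x hx
    rcases le_or_gt x q with h | h
    · rw [tailShift_of_le h]
      exact hb x hx h
    · rw [tailShift_of_lt h, abs_zero]
      positivity
  have hlow : μ.real {ω | N * (e + η) ≤ ∑ t, max (q - X t ω) 0} ≤
      Real.exp (-(N * ε ^ 2 * lam / (16 * M ^ 2))) := by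
    rw [← hexp]
    refine measureReal_sum_ge_le (f := fun x => max (q - x) 0) hlaw hindep (by fun_prop)
      measurableSet_Iic (fun x hx => max_eq_right (sub_nonpos.2 (not_le.1 hx).le)) ?_
      (by positivity) h0 hslam hη0 hηM
    filter_upwards [hM] with x hx
    rw [abs_of_nonneg (le_max_right _ _)]
    exact max_le (by linarith [neg_le_of_abs_le hx]) (by positivity)
  have hmid := hshift (q - M) fun x hx hxq => by
    obtain ⟨hx1, hx2⟩ := abs_le.1 hx
    exact abs_le.2 ⟨by linarith, by linarith⟩
  have hup := hshift c fun x hx hxq => by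
    obtain ⟨hx1, hx2⟩ := abs_le.1 hx
    exact abs_le.2 ⟨by linarith, by linarith⟩
  have hXM : ∀ᵐ ω ∂μ, ∀ t, |X t ω| ≤ M := by
    refine ae_all_iff.2 fun t => ?_
    have := hM
    rw [← (hlaw t).map_eq] at this
    exact ae_of_ae_map (hlaw t).aemeasurable this
  have hsub : {ω | ε < |avgValueAtRisk ν lam - avgValueAtRiskEstimator lam (fun t => X t ω)|}
      ≤ᵐ[μ] ({ω | N * (e + η) ≤ ∑ t, max (q - X t ω) 0} ∪
        {ω | N * (lam * (q - M) - e + η) ≤ ∑ t, tailShift q (q - M) (X t ω)} ∪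
        {ω | N * (lam * c - e + η) ≤ ∑ t, tailShift q c (X t ω)} : Set Ω) := by
    filter_upwards [hXM] with ω hω hdev
    obtain ⟨T, hest, -, hTlow, hTup⟩ := exists_tailMean hN h0 h1 (fun t => X t ω) hω
    change ε < |_| at hdev
    rw [avgValueAtRisk_eq ν h0 h1 hq hint, hest, ← mul_sub, abs_mul, abs_neg,
      abs_of_pos (by positivity : 0 < 1 / lam), one_div_mul_eq_div, lt_div_iff₀ h0,
      mul_comm ε lam, ← he, ← hη, lt_abs] at hdev
    rcases hdev with hdev | hdev
    · refine Or.inl (Or.inl ?_)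
      have h := hTlow q
      have h' : e + η ≤ 1 / N * ∑ t, max (q - X t ω) 0 := by linarith
      rw [one_div_mul_eq_div, le_div_iff₀ hN'] at h'
      change N * (e + η) ≤ _
      linarith
    · rcases sum_tailShift_ge_of_tailMean_gt (q := q) (e := e) (η := η) hN h0 _ hTup
        (by linarith) with h | h
      · exact Or.inl (Or.inr h)
      · exact Or.inr h
  have hmono : μ.real {ω | ε < |avgValueAtRisk ν lam -
      avgValueAtRiskEstimator lam (fun t => X t ω)|} ≤ μ.real _ :=
    ENNReal.toReal_mono (measure_ne_top _ _) (measure_mono_ae hsub)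
  have h2 := measureReal_union_le (μ := μ)
    ({ω | N * (e + η) ≤ ∑ t, max (q - X t ω) 0} ∪
      {ω | N * (lam * (q - M) - e + η) ≤ ∑ t, tailShift q (q - M) (X t ω)})
    {ω | N * (lam * c - e + η) ≤ ∑ t, tailShift q c (X t ω)}
  have h3 := measureReal_union_le (μ := μ) {ω | N * (e + η) ≤ ∑ t, max (q - X t ω) 0}
    {ω | N * (lam * (q - M) - e + η) ≤ ∑ t, tailShift q (q - M) (X t ω)}
  linarith

theorem mainTheorem7
    {Ω : Type*} [MeasurableSpace Ω] (μ : Measure Ω) [IsProbabilityMeasure μ]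
    (K N : ℕ)
    -- reward distribution, its density, and the `N` rewards of each of the `K` arms
    (F : Fin K → Measure ℝ) (d : Fin K → ℝ → ℝ) (X : Fin K → Fin N → Ω → ℝ)
    (hlaw : ∀ i t, HasLaw (X i t) (F i) μ)
    (hindep : ∀ i, iIndepFun (X i) μ)
    (hd_nonneg : ∀ i z, 0 ≤ d i z)
    (hdensity : ∀ i, F i = volume.withDensity (fun z => ENNReal.ofReal (d i z)))
    (hd_diff : ∀ i, ContDiff ℝ 1 (d i))
    (M D D' C₁ : ℝ)
    (hbound : ∀ i t, ∀ᵐ ω ∂μ, |X i t ω| ≤ M)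
    (hD : ∀ i z, d i z ≤ D)
    (hD' : ∀ i z, deriv (d i) z ≤ D')
    (hC₁ : 0 ≤ C₁)
    (lam ε δ : ℝ) (hlam_pos : 0 < lam) (hlam_le : lam ≤ 1) (hε : 0 < ε) (hδ : 0 < δ)
    -- the smallest real greater than `lam` whose product with `N` is an integer
    (lam' : ℝ) (hlam' : IsLeast {r : ℝ | lam < r ∧ ∃ k : ℤ, (N : ℝ) * r = k} lam')
    (hN : max (max (32 * lam' * M ^ 2 / (ε ^ 2 * lam ^ 2) * Real.log (2 / δ))
        (((1 / 6) * D' / D ^ 3 + 2 * C₁ * lam') / (ε * lam))) 2 ≤ (N : ℝ)) :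
    ∀ i, μ.real {ω | ε < |avgValueAtRisk (F i) lam -
        avgValueAtRiskEstimator lam (fun t => X i t ω)|} ≤ δ := by
  intro i
  have hN2 : (2 : ℝ) ≤ N := (le_max_right _ _).trans hN
  have hNpos : 0 < N := by
    have : 2 ≤ N := by exact_mod_cast hN2
    omega
  have : IsProbabilityMeasure (F i) := (hlaw i ⟨0, hNpos⟩).isProbabilityMeasure_iff.1 ‹_›
  have : NullSingletonClass (F i) := by
    rw [hdensity i]
    infer_instance
  have hM : ∀ᵐ x ∂F i, |x| ≤ M := by
    have hmeas : Measurable fun x : ℝ => |x| ≤ M :=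
      measurableSet_setOfPred.1 (measurableSet_le (by fun_prop) measurable_const)
    exact ((hlaw i ⟨0, hNpos⟩).ae_iff hmeas).1 (hbound i ⟨0, hNpos⟩)
  rcases lt_or_ge (2 * M) ε with hεM | hεM
  · have hnull : ∀ᵐ ω ∂μ, ¬ ε < |avgValueAtRisk (F i) lam -
        avgValueAtRiskEstimator lam (fun t => X i t ω)| := by
      filter_upwards [ae_all_iff.2 (hbound i)] with ω hω
      exact not_lt.2 ((abs_avgValueAtRisk_sub_estimator_le hM hNpos hlam_pos hlam_le hω).trans
        hεM.le)
    have hzero := ae_iff.1 hnull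
    simp only [not_not] at hzero
    rw [measureReal_def, hzero, ENNReal.toReal_zero]
    exact hδ.le
  rcases le_or_gt 1 δ with hδ1 | hδ1
  · exact measureReal_le_one.trans hδ1
  have hM0 : 0 < M := by linarith
  have hlt : lam < lam' := hlam'.1.1
  have hlam'_pos : 0 < lam' := hlam_pos.trans hlt
  refine (measureReal_lt_abs_avgValueAtRisk_sub_estimator_le hNpos (hlaw i) (hindep i) hM hM0
    hlam_pos hlam_le hε.le hεM).trans ?_
  have hlog : 32 * lam' * M ^ 2 / (ε ^ 2 * lam ^ 2) * Real.log (2 / δ) ≤ N :=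
    (le_max_left _ _).trans ((le_max_left _ _).trans hN)
  have hL0 : 0 ≤ Real.log (2 / δ) := Real.log_nonneg (by rw [le_div_iff₀ hδ]; linarith)
  have hexpo : 2 * Real.log (2 / δ) ≤ N * ε ^ 2 * lam / (16 * M ^ 2) := by
    rw [div_mul_eq_mul_div, div_le_iff₀ (by positivity)] at hlog
    rw [le_div_iff₀ (by positivity)]
    have h : lam * (2 * Real.log (2 / δ) * (16 * M ^ 2)) ≤ lam * (N * ε ^ 2 * lam) := by
      calc lam * (2 * Real.log (2 / δ) * (16 * M ^ 2))
          ≤ lam' * (2 * Real.log (2 / δ) * (16 * M ^ 2)) := by gcongr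
        _ = 32 * lam' * M ^ 2 * Real.log (2 / δ) := by ring
        _ ≤ N * (ε ^ 2 * lam ^ 2) := hlog
        _ = lam * (N * ε ^ 2 * lam) := by ring
    exact le_of_mul_le_mul_left h hlam_pos
  -- The exponent has room for `2 * log (2 / δ)`; the resulting square absorbs the factor `3` from
  -- the union bound.
  have hE : Real.exp (-(N * ε ^ 2 * lam / (16 * M ^ 2))) ≤ (δ / 2) ^ 2 := by
    calc Real.exp (-(N * ε ^ 2 * lam / (16 * M ^ 2))) ≤ Real.exp (-(2 * Real.log (2 / δ))) := by
          gcongr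
      _ = (δ / 2) ^ 2 := by
          rw [← inv_div 2 δ, inv_pow, Real.exp_neg]
          congr 1
          rw [show (2 : ℝ) * Real.log (2 / δ) = ((2 : ℕ) : ℝ) * Real.log (2 / δ) by norm_num,
            Real.exp_nat_mul, Real.exp_log (by positivity)]
  nlinarith
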